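/- Let $P$ be a Borel probability measure on $\mathbb R^l$ whose (topological) support $\Xi$ is compact and convex. Let $A\in\mathbb R^{n\times n}$, $q_1\in\mathbb R^n$, and let $B:\mathbb R^l\to\mathbb R^{n\times m}$, $M:\mathbb R^l\to\mathbb R^{m\times m}$, $N:\mathbb R^l\to\mathbb R^{m\times n}$, $q_2:\mathbb R^l\to\mathbb R^m$ be continuous. Write $\|\cdot\|$ for the Euclidean norm of vectors and the induced 2-norm of matrices, $\mathbb E$ for expectation with respect to $P$, and $0\le v\perp w\ge 0$ for $v\ge0$, $w\ge 0$ (componentwise), $v^Tw=0$. Assume that there is a function $\kappa$, positive and continuous on $\Xi$, with $\mathbb E[\kappa(\xi)]<\infty$, such that for $P$-almost every $\xi$ and all $z\in\mathbb R^n$, $u\in\mathbb R^m$ $$\begin{pmatrix}z^T,u^T\end{pmatrix}\begin{pmatrix}A&B(\xi)\\N(\xi)&M(\xi)\end{pmatrix}\begin{pmatrix}z\\u\end{pmatrix}\ge\kappa(\xi)\,(\|z\|^2+\|u\|^2).$$ Two-stage problem: $(x^*,y^*(\cdot))$ is a solution if $y^*$ is measurable, $B(\xi)y^*(\xi)$ is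 $P$-integrable, and $$0\le x^*\perp Ax^*+\mathbb E[B(\xi)y^*(\xi)]+q_1\ge0,\qquad 0\le y^*(\xi)\perp M(\xi)y^*(\xi)+N(\xi)x^*+q_2(\xi)\ge0\ \text{ for a.e. }\xi\in\Xi. \tag{1}$$ Discretized problem: let $\Xi=\bigcup_{i=1}^K\Xi_i^K$, where the $\Xi_i^K$ are compact and convex, have pairwise disjoint interiors, satisfy $P(\Xi_i^K\cap\Xi_j^K)=0$ for $i\ne j$, and have $p_i^K:=P(\Xi_i^K)>0$. Put $\mathbb E_{\Xi_i^K}[H(\xi)]=\frac1{p_i^K}\int_{\Xi_i^K}H\,dP$ and let $\Delta(\Xi_i^K)$ be the diameter of $\Xi_i^K$. A solution $(x^K,\mathbf y_1^K,\dots,\mathbf y_K^K)$ satisfies $$0\le x^K\perp Ax^K+\sum_{i=1}^Kp_i^K\,\mathbb E_{\Xi_i^K}[B(\xi)]\mathbf y_i^K+q_1\ge0,\qquad 0\le\mathbf y_i^K\perp\mathbb E_{\Xi_i^K}[M(\xi)]\mathbf y_i^K+\mathbb E_{\Xi_i^K}[N(\xi)]x^K+\mathbb E_{\Xi_i^K}[q_2(\xi)]\ge0\quad(i=1,\dots,K),$$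 and one puts $y^K(\xi)=\mathbf y_i^K$ for $\xi\in\Xi_i^K$ (at a point common to several cells, any of the corresponding values may be taken). Then there exist a number $\gamma>0$ and nonnegative $P$-integrable functions $c,h$ on $\mathbb R^l$, with $\|B(\xi)\|c(\xi)$ integrable, depending only on $P,A,q_1,B,M,N,q_2$ (in particular not on the partition), such that whenever $M$, $N$, $q_2$ and $B$ are Lipschitz continuous on $\Xi$ with constant $L$, then for every $K$, every such partition, and all solutions $(x^*,y^*(\cdot))$ and $(x^K,\mathbf y^K)$ of the two-stage problem and of the discretized problem, $$\|x^K-x^*\|\le\gamma\,\mathbb E[\|B(\xi)\|c(\xi)]\,L\max_{1\le i\le K}\Delta(\Xi_i^K)$$ and $$\|y^K(\xi)-y^*(\xi)\|\le h(\xi)\,L\max_{1\le i\le K}\Delta(\Xi_i^K)$$ for every $\xi\in\Xi$ at which $y^*(\xi)$ satisfies the second condition in (1); this is almost every $\xi\in\Xi$, and every $\xi\in\Xi$ if $y^*$ is chosen so that this condition holds everywhere on $\Xi$. -/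

import Mathlib

open MeasureTheory
open scoped NNReal

/-- `ℝᵏ` with the Euclidean norm. -/
abbrev Vec (k : ℕ) : Type := EuclideanSpace ℝ (Fin k)

/-- Real `a × b` matrices, regarded as linear maps `ℝᵇ → ℝᵃ`; the norm is the operator norm
for the Euclidean norms, which is the matrix 2-norm. -/
abbrev Mat (a b : ℕ) : Type := Vec b →L[ℝ] Vec a

/-- `0 ≤ x ⊥ w ≥ 0`, with componentwise inequalities. -/
structure Complementary {k : ℕ} (x w : Vec k) : Prop where
  nonneg_left : ∀ j, 0 ≤ x j
  nonneg_right : ∀ j, 0 ≤ w j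
  orthogonal : inner ℝ x w = 0

/-- The data of a two-stage stochastic linear complementarity problem: deterministic first-stage
data `A`, `q₁`, and coefficients `B`, `M`, `N`, `q₂` that are continuous in `ξ ∈ ℝˡ`. -/
structure SLCP (n m l : ℕ) where
  A : Mat n n
  q₁ : Vec n
  B : Vec l → Mat n m
  M : Vec l → Mat m m
  N : Vec l → Mat m n
  q₂ : Vec l → Vec m
  continuous_B : Continuous B
  continuous_M : Continuous M
  continuous_N : Continuous N
  continuous_q₂ : Continuous q₂

namespace SLCP

variable {n m l : ℕ}

/-- `y` solves the second-stage problem at `ξ` for the first-stage decision `x`: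
`0 ≤ y ⊥ M(ξ) y + N(ξ) x + q₂(ξ) ≥ 0`. -/
def SecondStage (D : SLCP n m l) (x : Vec n) (ξ : Vec l) (y : Vec m) : Prop :=
  Complementary y (D.M ξ y + D.N ξ x + D.q₂ ξ)

/-- `(x, y(·))` solves the two-stage problem when `ξ` has distribution `P`. -/
structure IsSolution (D : SLCP n m l) (P : Measure (Vec l)) (x : Vec n) (y : Vec l → Vec m) :
    Prop where
  measurable : AEStronglyMeasurable y P
  integrable : Integrable (fun ξ => D.B ξ (y ξ)) P
  first_stage : Complementary x (D.A x + ∫ ξ, D.B ξ (y ξ) ∂P + D.q₁)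
  second_stage : ∀ᵐ ξ ∂P, D.SecondStage x ξ (y ξ)

/-- There is a function `κ`, positive and continuous on the support of `P` and with finite
expectation, such that for almost every `ξ` the block matrix `[A, B(ξ); N(ξ), M(ξ)]` satisfies
`(z, u)ᵀ [A, B(ξ); N(ξ), M(ξ)] (z, u) ≥ κ(ξ) (‖z‖² + ‖u‖²)` for all `z`, `u`. -/
def StronglyMonotone (D : SLCP n m l) (P : Measure (Vec l)) : Prop :=
  ∃ κ : Vec l → ℝ, ContinuousOn κ P.support ∧ (∀ ξ ∈ P.support, 0 < κ ξ) ∧ Integrable κ P ∧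
    ∀ᵐ ξ ∂P, ∀ (z : Vec n) (u : Vec m),
      κ ξ * (‖z‖ ^ 2 + ‖u‖ ^ 2)
        ≤ inner ℝ z (D.A z + D.B ξ u) + inner ℝ u (D.N ξ z + D.M ξ u)

/-- The coefficients `M`, `N`, `q₂`, `B` are Lipschitz on the set `S` with constant `L`. -/
structure LipschitzCoeffs (D : SLCP n m l) (L : ℝ≥0) (S : Set (Vec l)) : Prop where
  lip_M : LipschitzOnWith L D.M S
  lip_N : LipschitzOnWith L D.N S
  lip_q₂ : LipschitzOnWith L D.q₂ S
  lip_B : LipschitzOnWith L D.B S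

/-- `(x, (y₁, …, y_K))` solves the problem discretized along the cells `Ξ₁, …, Ξ_K`, in which the
coefficients are replaced by their conditional expectations
`𝔼_{Ξᵢ}[H(ξ)] = P(Ξᵢ)⁻¹ ∫_{Ξᵢ} H dP` on the cells. -/
structure IsDiscreteSolution (D : SLCP n m l) (P : Measure (Vec l)) {K : ℕ}
    (Ξ : Fin K → Set (Vec l)) (x : Vec n) (y : Fin K → Vec m) : Prop where
  first_stage : Complementary x
    (D.A x + ∑ i, P.real (Ξ i) • (⨍ ξ in Ξ i, D.B ξ ∂P) (y i) + D.q₁)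
  second_stage : ∀ i, Complementary (y i)
    ((⨍ ξ in Ξ i, D.M ξ ∂P) (y i) + (⨍ ξ in Ξ i, D.N ξ ∂P) x + ⨍ ξ in Ξ i, D.q₂ ξ ∂P)

end SLCP

/-- A partition of the support of `P` into compact convex cells with disjoint interiors. The cells
have positive probability (so that conditional expectations on them make sense) and overlap only in
`P`-null sets (so that their probabilities add up to one). -/
structure IsCellPartition {l K : ℕ} (P : Measure (Vec l)) (Ξ : Fin K → Set (Vec l)) : Prop where
  isCompact : ∀ i, IsCompact (Ξ i)
  convex : ∀ i, Convex ℝ (Ξ i)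
  iUnion_eq : ⋃ i, Ξ i = P.support
  interior_disjoint : ∀ i j, i ≠ j → interior (Ξ i) ∩ interior (Ξ j) = ∅
  null_overlap : ∀ i j, i ≠ j → P (Ξ i ∩ Ξ j) = 0
  pos : ∀ i, 0 < P (Ξ i)

/-- The mesh size `maxᵢ Δ(Ξᵢ)`, where `Δ` is the diameter. -/
noncomputable def mesh {l K : ℕ} (Ξ : Fin K → Set (Vec l)) : ℝ :=
  ⨆ i, Metric.diam (Ξ i)

/-! Compactness of the support turns `κ` into a positive constant, and cell averages inherit the
resulting coercivity. Testing discrete solutions against themselves gives bounds on `xK` and `yK`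
independent of the partition (`norm_discrete_first_le`, `norm_discrete_second_le`). Seen from a
point `ξ` of a cell, a discrete solution solves the original problem up to a residual of order `L *
mesh Ξ`.

Solution maps of complementarity problems are monotone: differences of solutions and of slacks have
nonpositive inner product. With `z = xK - x`, coercivity at `(z, yK i - y ξ)` leaves an error `δ *
‖yK i - y ξ‖`, absorbed by completing the square. Integrating over the cells and adding the
first-stage inequality gives `‖z‖ ≤ δ / κ` (`norm_first_sub_le`). Coercivity at `(0, yK i - y ξ)`
then controls the second stage pointwise (`norm_second_sub_le`). -/

section Complementarity

variable {k : ℕ} {x x' w w' : Vec k}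

theorem inner_nonneg_of_coord_nonneg (hx : ∀ j, 0 ≤ x j) (hw : ∀ j, 0 ≤ w j) :
    0 ≤ inner ℝ x w := by
  rw [PiLp.inner_apply]
  exact Finset.sum_nonneg fun j _ => mul_nonneg (hw j) (hx j)

/-- On expansion the diagonal terms vanish by orthogonality, and the nonnegative cross terms carry
minus signs. -/
theorem Complementary.inner_sub_sub_nonpos (h : Complementary x w) (h' : Complementary x' w') :
    inner ℝ (x - x') (w - w') ≤ 0 := by
  have h₁ := inner_nonneg_of_coord_nonneg h.nonneg_left h'.nonneg_right
  have h₂ := inner_nonneg_of_coord_nonneg h'.nonneg_left h.nonneg_right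
  simp only [inner_sub_left, inner_sub_right, h.orthogonal, h'.orthogonal]
  linarith

end Complementarity

/-! ### Scalar quadratic inequalities -/

section Quadratic

/-- Completing the square. This removes the second-stage unknown from the estimates, so
integrability of `y` itself is never needed. -/
theorem mul_sq_sub_mul_ge {κ : ℝ} (hκ : 0 < κ) (s δ : ℝ) :
    -(δ ^ 2 / (4 * κ)) ≤ κ * s ^ 2 - δ * s := by
  have h : κ * s ^ 2 - δ * s + δ ^ 2 / (4 * κ) = (2 * κ * s - δ) ^ 2 / (4 * κ) := by
    field_simp
    ring
  have : 0 ≤ (2 * κ * s - δ) ^ 2 / (4 * κ) := by positivity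
  linarith

theorem mul_le_of_mul_sq_le_mul {κ s t : ℝ} (hs : 0 ≤ s) (ht : 0 ≤ t)
    (h : κ * s ^ 2 ≤ s * t) : κ * s ≤ t := by
  rcases hs.eq_or_lt with rfl | hs
  · simpa using ht
  · nlinarith

theorem le_div_of_mul_sq_le_add {κ s q r : ℝ} (hκ : 0 < κ) (hq : 0 ≤ q) (hr : 0 ≤ r)
    (h : κ * s ^ 2 ≤ q * s + r ^ 2 / (4 * κ)) : s ≤ (q + r) / κ := by
  rw [le_div_iff₀ hκ]
  by_contra! hlt
  have h₁ : κ * (r ^ 2 / (4 * κ)) = r ^ 2 / 4 := by field_simp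
  have h₂ := mul_le_mul_of_nonneg_left h hκ.le
  nlinarith

end Quadratic

theorem Continuous.integrable_of_isCompact_support {l : ℕ} {P : Measure (Vec l)}
    [IsFiniteMeasure P] {E : Type*} [NormedAddCommGroup E] (hP : IsCompact P.support)
    {H : Vec l → E} (hH : Continuous H) : Integrable H P := by
  have hi : IntegrableOn H P.support P := hH.continuousOn.integrableOn_compact hP
  have hae : ∀ᵐ ξ ∂P, ξ ∈ P.support := Measure.support_mem_ae
  rwa [IntegrableOn, Measure.restrict_eq_self_of_ae_mem hae] at hi

/-! ### Averages over cells -/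

section Averages

variable {l : ℕ} {P : Measure (Vec l)} [IsProbabilityMeasure P] {S : Set (Vec l)}
  {E : Type*} [NormedAddCommGroup E] [NormedSpace ℝ E] [CompleteSpace E]

theorem measureReal_mul_inner_setAverage {a b : ℕ} (hS : IsCompact S) {H : Vec l → Mat a b}
    (hH : Continuous H) (z : Vec a) (u : Vec b) :
    P.real S * inner ℝ z ((⨍ ξ in S, H ξ ∂P) u) = ∫ ξ in S, inner ℝ z (H ξ u) ∂P := by
  have hi : IntegrableOn H S P := hH.continuousOn.integrableOn_compact hS
  rw [← inner_smul_right, ← smul_apply,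
    measure_smul_setAverage _ (measure_ne_top P S), ContinuousLinearMap.integral_apply hi,
    integral_inner (hi.apply_continuousLinearMap u)]

/-- Closed balls are closed and convex, hence stable under averaging. The centre `0` gives bounds on
averaged coefficients, the centre `H ξ` gives Lipschitz errors. -/
theorem setAverage_mem_closedBall (hS : IsCompact S) (hP : 0 < P S) {H : Vec l → E}
    (hH : Continuous H) {e : E} {r : ℝ} (h : ∀ ξ ∈ S, ‖H ξ - e‖ ≤ r) :
    ‖(⨍ ξ in S, H ξ ∂P) - e‖ ≤ r := by
  rw [← mem_closedBall_iff_norm]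
  refine (convex_closedBall e r).set_average_mem Metric.isClosed_closedBall hP.ne'
    (measure_ne_top P S) ?_ (hH.continuousOn.integrableOn_compact hS)
  exact (ae_restrict_mem hS.measurableSet).mono fun ξ hξ => mem_closedBall_iff_norm.2 (h ξ hξ)

theorem norm_setAverage_sub_le_of_lipschitzOnWith (hS : IsCompact S) (hP : 0 < P S)
    {H : Vec l → E} (hH : Continuous H) {L : ℝ≥0} (hL : LipschitzOnWith L H S) {ξ : Vec l}
    (hξ : ξ ∈ S) {d : ℝ} (hd : Metric.diam S ≤ d) :
    ‖(⨍ η in S, H η ∂P) - H ξ‖ ≤ L * d := by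
  refine setAverage_mem_closedBall hS hP hH fun η hη => ?_
  rw [← dist_eq_norm]
  refine (hL.dist_le_mul η hη ξ hξ).trans ?_
  gcongr
  exact (Metric.dist_le_diam_of_mem hS.isBounded hη hξ).trans hd

end Averages

namespace IsCellPartition

variable {l K : ℕ} {P : Measure (Vec l)} {Ξ : Fin K → Set (Vec l)}

theorem subset_support (hΞ : IsCellPartition P Ξ) (i : Fin K) : Ξ i ⊆ P.support :=
  hΞ.iUnion_eq ▸ Set.subset_iUnion Ξ i

theorem integral_eq_sum (hΞ : IsCellPartition P Ξ) {f : Vec l → ℝ} (hf : Integrable f P) :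
    ∫ ξ, f ξ ∂P = ∑ i, ∫ ξ in Ξ i, f ξ ∂P := by
  have h := integral_iUnion_ae (f := f) (μ := P) (s := Ξ)
    (fun i => (hΞ.isCompact i).measurableSet.nullMeasurableSet)
    (fun i j hij => hΞ.null_overlap i j hij) hf.integrableOn
  rw [tsum_fintype, hΞ.iUnion_eq] at h
  rw [← h, setIntegral_eq_integral_of_ae_compl_eq_zero]
  filter_upwards [Measure.support_mem_ae (μ := P)] with ξ hξ hn using absurd hξ hn

theorem sum_measureReal [IsProbabilityMeasure P] (hΞ : IsCellPartition P Ξ) : ∑ i, P.real (Ξ i) = 1 := by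
  simpa using (hΞ.integral_eq_sum (integrable_const (1 : ℝ))).symm

theorem diam_le_mesh (Ξ : Fin K → Set (Vec l)) (i : Fin K) : Metric.diam (Ξ i) ≤ mesh Ξ :=
  le_ciSup (f := fun i => Metric.diam (Ξ i)) (Set.finite_range _).bddAbove i

end IsCellPartition

theorem mesh_nonneg {l K : ℕ} (Ξ : Fin K → Set (Vec l)) : 0 ≤ mesh Ξ :=
  Real.iSup_nonneg fun _ => Metric.diam_nonneg

/-! ### Uniform coercivity and coefficient bounds -/

namespace SLCP

variable {n m l : ℕ}

/-- The block quadratic form `(z, u)ᵀ [A, B(ξ); N(ξ), M(ξ)] (z, u)` is bounded below by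
`κ (‖z‖² + ‖u‖²)` at every `ξ ∈ S`, with a constant `κ > 0`, and all coefficients are bounded by
`C` on `S`. -/
structure UniformBounds (D : SLCP n m l) (S : Set (Vec l)) (κ C : ℝ) : Prop where
  pos : 0 < κ
  coercive : ∀ ξ ∈ S, ∀ (z : Vec n) (u : Vec m), κ * (‖z‖ ^ 2 + ‖u‖ ^ 2)
    ≤ inner ℝ z (D.A z + D.B ξ u) + inner ℝ u (D.N ξ z + D.M ξ u)
  nonneg : 0 ≤ C
  norm_N_le : ∀ ξ ∈ S, ‖D.N ξ‖ ≤ C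
  norm_q₂_le : ∀ ξ ∈ S, ‖D.q₂ ξ‖ ≤ C

section

variable {D : SLCP n m l} {P : Measure (Vec l)} [IsProbabilityMeasure P] {κ C : ℝ}

theorem StronglyMonotone.exists_uniformBounds (hcompact : IsCompact P.support)
    (hmono : D.StronglyMonotone P) : ∃ κ C, D.UniformBounds P.support κ C := by
  obtain ⟨κ, hc, hpos, -, hae⟩ := hmono
  obtain ⟨ξ₀, hξ₀, hmin⟩ := hcompact.exists_isMinOn
    (Measure.nonempty_support (IsProbabilityMeasure.ne_zero P)) hc
  obtain ⟨C₁, h₁⟩ := hcompact.exists_bound_of_continuousOn D.continuous_N.continuousOn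
  obtain ⟨C₂, h₂⟩ := hcompact.exists_bound_of_continuousOn D.continuous_q₂.continuousOn
  have h₀ : 0 ≤ C₁ := (norm_nonneg _).trans (h₁ ξ₀ hξ₀)
  refine ⟨κ ξ₀, max C₁ C₂, hpos ξ₀ hξ₀, ?_, h₀.trans (le_max_left _ _),
    fun ξ hξ => (h₁ ξ hξ).trans (le_max_left _ _), fun ξ hξ => (h₂ ξ hξ).trans (le_max_right _ _)⟩
  intro ξ hξ z u
  have hB := D.continuous_B
  have hN := D.continuous_N
  have hM := D.continuous_M
  have hclosed : IsClosed {ξ | κ ξ₀ * (‖z‖ ^ 2 + ‖u‖ ^ 2)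
      ≤ inner ℝ z (D.A z + D.B ξ u) + inner ℝ u (D.N ξ z + D.M ξ u)} :=
    isClosed_le continuous_const (by fun_prop)
  -- For fixed `z`, `u` the inequality with the constant minimum is a closed condition on `ξ`;
  -- holding almost everywhere, it holds on the whole support.
  refine Measure.support_subset_of_isClosed hclosed ?_ hξ
  filter_upwards [hae, Measure.support_mem_ae (μ := P)] with η hη hηS
  exact (mul_le_mul_of_nonneg_right (hmin hηS) (by positivity)).trans (hη z u)

namespace UniformBounds

/-- Coercivity is inherited by the conditional expectations of the coefficients on a cell. -/
theorem coercive_setAverage (hD : D.UniformBounds P.support κ C) {S : Set (Vec l)}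
    (hS : IsCompact S) (hP : 0 < P S) (hsub : S ⊆ P.support) (z : Vec n) (u : Vec m) :
    κ * (‖z‖ ^ 2 + ‖u‖ ^ 2) ≤ inner ℝ z (D.A z + (⨍ ξ in S, D.B ξ ∂P) u)
      + inner ℝ u ((⨍ ξ in S, D.N ξ ∂P) z + (⨍ ξ in S, D.M ξ ∂P) u) := by
  have hBc := D.continuous_B
  have hNc := D.continuous_N
  have hMc := D.continuous_M
  have hB : IntegrableOn (fun ξ => inner ℝ z (D.B ξ u)) S P :=
    (by fun_prop : Continuous _).continuousOn.integrableOn_compact hS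
  have hN : IntegrableOn (fun ξ => inner ℝ u (D.N ξ z)) S P :=
    (by fun_prop : Continuous _).continuousOn.integrableOn_compact hS
  have hM : IntegrableOn (fun ξ => inner ℝ u (D.M ξ u)) S P :=
    (by fun_prop : Continuous _).continuousOn.integrableOn_compact hS
  have hle : P.real S * (κ * (‖z‖ ^ 2 + ‖u‖ ^ 2) - inner ℝ z (D.A z))
      ≤ ∫ ξ in S, (inner ℝ z (D.B ξ u) + (inner ℝ u (D.N ξ z) + inner ℝ u (D.M ξ u))) ∂P := by
    rw [← smul_eq_mul, ← setIntegral_const]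
    refine setIntegral_mono_on (integrable_const _) (hB.add (hN.add hM)) hS.measurableSet
      fun ξ hξ => ?_
    have := hD.coercive ξ (hsub hξ) z u
    simp only [inner_add_right] at this
    linarith
  have hNM : IntegrableOn (fun ξ => inner ℝ u (D.N ξ z) + inner ℝ u (D.M ξ u)) S P := hN.add hM
  rw [integral_add hB hNM, integral_add hN hM,
    ← measureReal_mul_inner_setAverage hS hBc, ← measureReal_mul_inner_setAverage hS hNc,
    ← measureReal_mul_inner_setAverage hS hMc, ← mul_add, ← mul_add] at hle
  have := le_of_mul_le_mul_left hle (ENNReal.toReal_pos hP.ne' (measure_ne_top P S))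
  simp only [inner_add_right]
  linarith

/-! ### A priori bounds for discrete solutions -/

variable {K : ℕ} {Ξ : Fin K → Set (Vec l)} {x xK : Vec n} {y : Vec l → Vec m} {yK : Fin K → Vec m}

theorem norm_setAverage_q₂_le (hD : D.UniformBounds P.support κ C) (hΞ : IsCellPartition P Ξ)
    (i : Fin K) : ‖⨍ ξ in Ξ i, D.q₂ ξ ∂P‖ ≤ C := by
  simpa using setAverage_mem_closedBall (e := 0) (hΞ.isCompact i) (hΞ.pos i) D.continuous_q₂
    fun ξ hξ => by simpa using hD.norm_q₂_le ξ (hΞ.subset_support i hξ)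

theorem norm_setAverage_N_le (hD : D.UniformBounds P.support κ C) (hΞ : IsCellPartition P Ξ)
    (i : Fin K) : ‖⨍ ξ in Ξ i, D.N ξ ∂P‖ ≤ C := by
  simpa using setAverage_mem_closedBall (e := 0) (hΞ.isCompact i) (hΞ.pos i) D.continuous_N
    fun ξ hξ => by simpa using hD.norm_N_le ξ (hΞ.subset_support i hξ)

/-- An a priori bound on the first-stage decision of the discretized problem. -/
theorem norm_discrete_first_le (hD : D.UniformBounds P.support κ C) (hΞ : IsCellPartition P Ξ)
    (h : D.IsDiscreteSolution P Ξ xK yK) : ‖xK‖ ≤ (‖D.q₁‖ + C) / κ := by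
  refine le_div_of_mul_sq_le_add hD.pos (norm_nonneg _) hD.nonneg ?_
  -- Orthogonality reduces the second-stage part of the form to minus the pairing of `yK i` with the
  -- averaged `q₂`; completing the square then eliminates `yK i`.
  have hcell : ∀ i, κ * ‖xK‖ ^ 2 - C ^ 2 / (4 * κ) - inner ℝ xK (D.A xK)
      ≤ inner ℝ xK ((⨍ ξ in Ξ i, D.B ξ ∂P) (yK i)) := fun i => by
    have h₁ := hD.coercive_setAverage (hΞ.isCompact i) (hΞ.pos i) (hΞ.subset_support i) xK (yK i)
    have h₂ := (h.second_stage i).orthogonal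
    have h₃ := (abs_le.1 (abs_real_inner_le_norm (yK i) (⨍ ξ in Ξ i, D.q₂ ξ ∂P))).1
    have h₄ := mul_le_mul_of_nonneg_left (hD.norm_setAverage_q₂_le hΞ i) (norm_nonneg (yK i))
    have h₅ := mul_sq_sub_mul_ge hD.pos ‖yK i‖ C
    simp only [inner_add_right] at h₁ h₂
    linarith
  have hsum : ∑ i, P.real (Ξ i) * (κ * ‖xK‖ ^ 2 - C ^ 2 / (4 * κ) - inner ℝ xK (D.A xK))
      ≤ ∑ i, P.real (Ξ i) * inner ℝ xK ((⨍ ξ in Ξ i, D.B ξ ∂P) (yK i)) :=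
    Finset.sum_le_sum fun i _ => mul_le_mul_of_nonneg_left (hcell i) measureReal_nonneg
  rw [← Finset.sum_mul, hΞ.sum_measureReal, one_mul] at hsum
  have horth := h.first_stage.orthogonal
  simp only [inner_add_right, inner_sum, inner_smul_right] at horth
  have hq := (abs_le.1 (abs_real_inner_le_norm xK D.q₁)).1
  linarith

/-- An a priori bound on the second-stage decisions of the discretized problem. -/
theorem norm_discrete_second_le (hD : D.UniformBounds P.support κ C) (hΞ : IsCellPartition P Ξ)
    (h : D.IsDiscreteSolution P Ξ xK yK) (i : Fin K) : ‖yK i‖ ≤ (C * ‖xK‖ + C) / κ := by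
  rw [le_div_iff₀' hD.pos]
  have hC := hD.nonneg
  refine mul_le_of_mul_sq_le_mul (norm_nonneg _) (by positivity) ?_
  have h₁ := hD.coercive_setAverage (hΞ.isCompact i) (hΞ.pos i) (hΞ.subset_support i) 0 (yK i)
  have h₂ := (h.second_stage i).orthogonal
  have h₃ := (abs_le.1 (abs_real_inner_le_norm (yK i)
    ((⨍ ξ in Ξ i, D.N ξ ∂P) xK + ⨍ ξ in Ξ i, D.q₂ ξ ∂P))).1
  have h₄ : ‖(⨍ ξ in Ξ i, D.N ξ ∂P) xK + ⨍ ξ in Ξ i, D.q₂ ξ ∂P‖ ≤ C * ‖xK‖ + C :=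
    norm_add_le_of_le (ContinuousLinearMap.le_of_opNorm_le _ (hD.norm_setAverage_N_le hΞ i) _)
      (hD.norm_setAverage_q₂_le hΞ i)
  have h₅ := mul_le_mul_of_nonneg_left h₄ (norm_nonneg (yK i))
  simp only [inner_add_right, inner_zero_left, map_zero, inner_zero_right, norm_zero] at h₁ h₂ h₃
  norm_num at h₁
  linarith

end UniformBounds

/-! ### Comparison of the discrete and the original problem -/

variable {K : ℕ} {Ξ : Fin K → Set (Vec l)} {x xK : Vec n} {y : Vec l → Vec m} {yK : Fin K → Vec m}

/-- The residual in the second-stage problem at `ξ` of replacing the coefficients by their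
conditional expectations on a cell. -/
noncomputable def residual (D : SLCP n m l) (P : Measure (Vec l)) (S : Set (Vec l)) (x : Vec n)
    (y : Vec m) (ξ : Vec l) : Vec m :=
  ((⨍ η in S, D.M η ∂P) - D.M ξ) y + ((⨍ η in S, D.N η ∂P) - D.N ξ) x
    + ((⨍ η in S, D.q₂ η ∂P) - D.q₂ ξ)

theorem LipschitzCoeffs.norm_residual_le {L : ℝ≥0} (hL : D.LipschitzCoeffs L P.support)
    (hΞ : IsCellPartition P Ξ) {i : Fin K} {ξ : Vec l} (hξ : ξ ∈ Ξ i) (x : Vec n) (y : Vec m) :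
    ‖D.residual P (Ξ i) x y ξ‖ ≤ L * mesh Ξ * (‖x‖ + ‖y‖ + 1) := by
  have hs := hΞ.subset_support i
  have hd := IsCellPartition.diam_le_mesh Ξ i
  have hM := norm_setAverage_sub_le_of_lipschitzOnWith (hΞ.isCompact i) (hΞ.pos i)
    D.continuous_M (hL.lip_M.mono hs) hξ hd
  have hN := norm_setAverage_sub_le_of_lipschitzOnWith (hΞ.isCompact i) (hΞ.pos i)
    D.continuous_N (hL.lip_N.mono hs) hξ hd
  have hq := norm_setAverage_sub_le_of_lipschitzOnWith (hΞ.isCompact i) (hΞ.pos i)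
    D.continuous_q₂ (hL.lip_q₂.mono hs) hξ hd
  refine (norm_add_le_of_le (norm_add_le_of_le (ContinuousLinearMap.le_of_opNorm_le _ hM y)
    (ContinuousLinearMap.le_of_opNorm_le _ hN x)) hq).trans_eq ?_
  ring

omit [IsProbabilityMeasure P] in
-- The two slacks differ by the linear expression on the left plus the residual, so monotonicity and
-- Cauchy–Schwarz suffice.
theorem IsDiscreteSolution.inner_second_stage_le (h : D.IsDiscreteSolution P Ξ xK yK) (i : Fin K)
    {ξ : Vec l} {v : Vec m} (hv : D.SecondStage x ξ v) :
    inner ℝ (yK i - v) (D.N ξ (xK - x) + D.M ξ (yK i - v))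
      ≤ ‖yK i - v‖ * ‖D.residual P (Ξ i) xK (yK i) ξ‖ := by
  have h₁ := (h.second_stage i).inner_sub_sub_nonpos hv
  have h₂ := (abs_le.1 (abs_real_inner_le_norm (yK i - v)
    (D.residual P (Ξ i) xK (yK i) ξ))).1
  have h₃ : (⨍ ξ in Ξ i, D.M ξ ∂P) (yK i) + (⨍ ξ in Ξ i, D.N ξ ∂P) xK + (⨍ ξ in Ξ i, D.q₂ ξ ∂P)
      - (D.M ξ v + D.N ξ x + D.q₂ ξ)
      = (D.N ξ (xK - x) + D.M ξ (yK i - v)) + D.residual P (Ξ i) xK (yK i) ξ := by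
    simp only [residual, sub_apply, map_sub]
    abel
  rw [h₃, inner_add_right] at h₁
  linarith

theorem IsSolution.integrable_inner_sub (h : D.IsSolution P x y) (hcompact : IsCompact P.support)
    (z : Vec n) (v : Vec m) : Integrable (fun ξ => inner ℝ z (D.B ξ (v - y ξ))) P := by
  have hB := D.continuous_B
  have hv : Integrable (fun ξ => D.B ξ v) P :=
    (by fun_prop : Continuous _).integrable_of_isCompact_support hcompact
  simpa only [map_sub, Pi.sub_apply] using (hv.sub h.integrable).const_inner z

/-- The complementarity conditions of the two first-stage problems, tested against each other. -/
theorem IsSolution.inner_first_stage_le (hΞ : IsCellPartition P Ξ)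
    (h : D.IsSolution P x y) (h' : D.IsDiscreteSolution P Ξ xK yK) :
    inner ℝ (xK - x) (D.A (xK - x))
      + ∑ i, ∫ ξ in Ξ i, inner ℝ (xK - x) (D.B ξ (yK i - y ξ)) ∂P ≤ 0 := by
  have hB := D.continuous_B
  have h₁ := h'.first_stage.inner_sub_sub_nonpos h.first_stage
  set z := xK - x
  have hy : Integrable (fun ξ => inner ℝ z (D.B ξ (y ξ))) P := h.integrable.const_inner z
  have h₂ : inner ℝ z (∫ ξ, D.B ξ (y ξ) ∂P) = ∑ i, ∫ ξ in Ξ i, inner ℝ z (D.B ξ (y ξ)) ∂P := by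
    rw [← hΞ.integral_eq_sum hy, integral_inner h.integrable]
  have h₃ : ∀ i, inner ℝ z (P.real (Ξ i) • (⨍ ξ in Ξ i, D.B ξ ∂P) (yK i))
      = ∫ ξ in Ξ i, inner ℝ z (D.B ξ (yK i)) ∂P := fun i => by
    rw [inner_smul_right, measureReal_mul_inner_setAverage (hΞ.isCompact i) D.continuous_B]
  have h₄ : ∀ i, ∫ ξ in Ξ i, inner ℝ z (D.B ξ (yK i - y ξ)) ∂P
      = ∫ ξ in Ξ i, inner ℝ z (D.B ξ (yK i)) ∂P - ∫ ξ in Ξ i, inner ℝ z (D.B ξ (y ξ)) ∂P :=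
    fun i => by
      simp only [map_sub, inner_sub_right]
      exact integral_sub ((by fun_prop : Continuous fun ξ => inner ℝ z (D.B ξ (yK i))).continuousOn
        |>.integrableOn_compact (hΞ.isCompact i)) hy.integrableOn
  have h₅ : inner ℝ z (D.A z) = inner ℝ z (D.A xK) - inner ℝ z (D.A x) := by
    rw [← inner_sub_right, ← map_sub]
  simp only [inner_sub_right, inner_add_right, inner_sum, h₂, h₃] at h₁
  rw [h₅, Finset.sum_congr rfl fun i _ => h₄ i, Finset.sum_sub_distrib]
  linarith

/-! ### Error estimates -/

namespace UniformBounds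

theorem norm_first_sub_le (hD : D.UniformBounds P.support κ C) (hcompact : IsCompact P.support)
    (hΞ : IsCellPartition P Ξ) (h : D.IsSolution P x y) (h' : D.IsDiscreteSolution P Ξ xK yK)
    {δ : ℝ} (hδ₀ : 0 ≤ δ) (hδ : ∀ i, ∀ ξ ∈ Ξ i, ‖D.residual P (Ξ i) xK (yK i) ξ‖ ≤ δ) :
    ‖xK - x‖ ≤ δ / κ := by
  have hle := h.inner_first_stage_le hΞ h'
  set z := xK - x
  -- A lower bound for the integrand that does not depend on `ξ` or on the cell; since the
  -- probabilities sum to one, summation returns `r` itself.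
  set r := κ * ‖z‖ ^ 2 - δ ^ 2 / (4 * κ) - inner ℝ z (D.A z) with hr
  have hcell : ∀ i, P.real (Ξ i) * r ≤ ∫ ξ in Ξ i, inner ℝ z (D.B ξ (yK i - y ξ)) ∂P := fun i => by
    have hconst : ∫ _ in Ξ i, r ∂P = P.real (Ξ i) * r := by
      rw [setIntegral_const, smul_eq_mul]
    rw [← hconst]
    refine integral_mono_ae (integrable_const _)
      (h.integrable_inner_sub hcompact z (yK i)).integrableOn ?_
    filter_upwards [ae_restrict_mem (hΞ.isCompact i).measurableSet,
      ae_restrict_of_ae h.second_stage] with ξ hξ hsec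
    have h₁ := hD.coercive ξ (hΞ.subset_support i hξ) z (yK i - y ξ)
    have h₂ := h'.inner_second_stage_le i hsec
    have h₃ := mul_le_mul_of_nonneg_left (hδ i ξ hξ) (norm_nonneg (yK i - y ξ))
    have h₄ := mul_sq_sub_mul_ge hD.pos ‖yK i - y ξ‖ δ
    rw [inner_add_right z] at h₁
    linarith
  have hsum := Finset.sum_le_sum fun i (_ : i ∈ Finset.univ) => hcell i
  rw [← Finset.sum_mul, hΞ.sum_measureReal, one_mul] at hsum
  simpa using le_div_of_mul_sq_le_add (s := ‖z‖) hD.pos le_rfl hδ₀ (by linarith)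

/-- If `B` vanishes on the support, the first stage decouples from the second one. -/
theorem first_eq_of_B_eq_zero (hD : D.UniformBounds P.support κ C)
    (hΞ : IsCellPartition P Ξ) (h : D.IsSolution P x y) (h' : D.IsDiscreteSolution P Ξ xK yK) (hB : ∀ ξ ∈ P.support, D.B ξ = 0) : xK = x := by
  have hle := h.inner_first_stage_le hΞ h'
  have hzero : ∀ i, ∫ ξ in Ξ i, inner ℝ (xK - x) (D.B ξ (yK i - y ξ)) ∂P = 0 := fun i =>
    setIntegral_eq_zero_of_forall_eq_zero fun ξ hξ => by
      simp [hB ξ (hΞ.subset_support i hξ)]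
  obtain ⟨ξ, hξ⟩ := Measure.nonempty_support (IsProbabilityMeasure.ne_zero P)
  have h₁ := hD.coercive ξ hξ (xK - x) 0
  simp only [hzero, Finset.sum_const_zero, add_zero] at hle
  simp only [map_zero, add_zero, inner_zero_left, norm_zero] at h₁
  have h₂ : ‖xK - x‖ ^ 2 ≤ 0 := by nlinarith [hD.pos]
  have h₃ : ‖xK - x‖ = 0 := by nlinarith [norm_nonneg (xK - x)]
  exact sub_eq_zero.1 (norm_eq_zero.1 h₃)

theorem norm_second_sub_le (hD : D.UniformBounds P.support κ C) (hΞ : IsCellPartition P Ξ)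
    (h' : D.IsDiscreteSolution P Ξ xK yK) {i : Fin K} {ξ : Vec l} (hξ : ξ ∈ Ξ i) {v : Vec m}
    (hv : D.SecondStage x ξ v) :
    ‖yK i - v‖ ≤ (C * ‖xK - x‖ + ‖D.residual P (Ξ i) xK (yK i) ξ‖) / κ := by
  have hC := hD.nonneg
  have hs := hΞ.subset_support i hξ
  rw [le_div_iff₀' hD.pos]
  refine mul_le_of_mul_sq_le_mul (norm_nonneg _) (by positivity) ?_
  have h₁ := hD.coercive ξ hs 0 (yK i - v)
  have h₂ := h'.inner_second_stage_le i hv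
  have h₃ := (abs_le.1 (abs_real_inner_le_norm (yK i - v) (D.N ξ (xK - x)))).1
  have h₄ := mul_le_mul_of_nonneg_left
    (ContinuousLinearMap.le_of_opNorm_le _ (hD.norm_N_le ξ hs) (xK - x)) (norm_nonneg (yK i - v))
  rw [inner_add_right] at h₂
  simp only [inner_zero_left, map_zero, norm_zero, zero_add] at h₁
  rw [zero_pow two_ne_zero, zero_add] at h₁
  linarith

end UniformBounds

end

end SLCP

/-! ### Choice of constants and conclusion -/

theorem mainTheorem3 {n m l : ℕ} (D : SLCP n m l)
    (P : Measure (Vec l)) [IsProbabilityMeasure P]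
    (hcompact : IsCompact P.support) (hconvex : Convex ℝ P.support)
    (hmono : D.StronglyMonotone P) :
    ∃ (γ : ℝ) (c h : Vec l → ℝ),
      0 < γ ∧ (∀ ξ, 0 ≤ c ξ) ∧ (∀ ξ, 0 ≤ h ξ) ∧
      Integrable c P ∧ Integrable h P ∧ Integrable (fun ξ => ‖D.B ξ‖ * c ξ) P ∧
      ∀ L : ℝ≥0, D.LipschitzCoeffs L P.support →
      ∀ (K : ℕ) (Ξ : Fin K → Set (Vec l)), IsCellPartition P Ξ →
      ∀ (x : Vec n) (y : Vec l → Vec m), D.IsSolution P x y →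
      ∀ (xK : Vec n) (yK : Fin K → Vec m), D.IsDiscreteSolution P Ξ xK yK →
        ‖xK - x‖ ≤ γ * (∫ ξ, ‖D.B ξ‖ * c ξ ∂P) * L * mesh Ξ ∧
        ∀ i, ∀ ξ ∈ Ξ i, D.SecondStage x ξ (y ξ) →
          ‖yK i - y ξ‖ ≤ h ξ * L * mesh Ξ := by
  obtain ⟨κ, C, hD⟩ := hmono.exists_uniformBounds hcompact
  have hκ := hD.pos
  have hC := hD.nonneg
  let R : ℝ := (‖D.q₁‖ + C) / κ
  -- The summands bound `‖xK‖` and `‖yK i‖`, and `1` accounts for `q₂`, matching the factor in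
  -- `norm_residual_le`.
  let R' : ℝ := R + (C * R + C) / κ + 1
  have hR : 0 ≤ R := by positivity
  have hR' : 0 < R' := by positivity
  have hBint : Integrable (fun ξ => ‖D.B ξ‖) P :=
    D.continuous_B.norm.integrable_of_isCompact_support hcompact
  have hEnonneg : 0 ≤ ∫ ξ, ‖D.B ξ‖ ∂P := integral_nonneg fun ξ => norm_nonneg _
  have hresidual : ∀ L : ℝ≥0, D.LipschitzCoeffs L P.support →
      ∀ (K : ℕ) (Ξ : Fin K → Set (Vec l)), IsCellPartition P Ξ →
      ∀ (xK : Vec n) (yK : Fin K → Vec m), D.IsDiscreteSolution P Ξ xK yK →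
      ∀ i, ∀ ξ ∈ Ξ i, ‖D.residual P (Ξ i) xK (yK i) ξ‖ ≤ L * mesh Ξ * R' := by
    intro L hL K Ξ hΞ xK yK hK i ξ hξ
    have hx : ‖xK‖ ≤ R := hD.norm_discrete_first_le hΞ hK
    have hy : ‖yK i‖ ≤ (C * R + C) / κ := by
      refine (hD.norm_discrete_second_le hΞ hK i).trans ?_
      gcongr
    refine (hL.norm_residual_le hΞ hξ xK (yK i)).trans ?_
    exact mul_le_mul_of_nonneg_left (by simp only [R']; linarith)
      (mul_nonneg L.coe_nonneg (mesh_nonneg Ξ))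
  have hfirst : ∀ L : ℝ≥0, D.LipschitzCoeffs L P.support →
      ∀ (K : ℕ) (Ξ : Fin K → Set (Vec l)), IsCellPartition P Ξ →
      ∀ (x : Vec n) (y : Vec l → Vec m), D.IsSolution P x y →
      ∀ (xK : Vec n) (yK : Fin K → Vec m), D.IsDiscreteSolution P Ξ xK yK →
        ‖xK - x‖ ≤ R' / κ * L * mesh Ξ := by
    intro L hL K Ξ hΞ x y hy xK yK hK
    have := mesh_nonneg Ξ
    refine (hD.norm_first_sub_le hcompact hΞ hy hK (by positivity)
      (hresidual L hL K Ξ hΞ xK yK hK)).trans_eq ?_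
    ring
  obtain ⟨γ, hγ, hγle⟩ : ∃ γ : ℝ, 0 < γ ∧ ∀ L : ℝ≥0, D.LipschitzCoeffs L P.support →
      ∀ (K : ℕ) (Ξ : Fin K → Set (Vec l)), IsCellPartition P Ξ →
      ∀ (x : Vec n) (y : Vec l → Vec m), D.IsSolution P x y →
      ∀ (xK : Vec n) (yK : Fin K → Vec m), D.IsDiscreteSolution P Ξ xK yK →
        ‖xK - x‖ ≤ γ * (∫ ξ, ‖D.B ξ‖ ∂P) * L * mesh Ξ := by
    -- If `𝔼‖B‖ = 0` the claimed bound is zero; continuity makes `B` vanish on the support, so `xK =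
    -- x`. Otherwise `γ` is normalised by `𝔼‖B‖`.
    rcases hEnonneg.eq_or_lt with hE | hE
    · refine ⟨1, one_pos, fun L hL K Ξ hΞ x y hy xK yK hK => ?_⟩
      have hae := (integral_eq_zero_iff_of_nonneg (fun ξ => norm_nonneg (D.B ξ)) hBint).1 hE.symm
      have hB : ∀ ξ ∈ P.support, D.B ξ = 0 := fun ξ hξ =>
        Measure.support_subset_of_isClosed (isClosed_eq D.continuous_B continuous_const)
          (hae.mono fun η hη => norm_eq_zero.1 hη) hξ
      simp [hD.first_eq_of_B_eq_zero hΞ hy hK hB, ← hE]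
    · refine ⟨R' / κ / ∫ ξ, ‖D.B ξ‖ ∂P, by positivity, ?_⟩
      rwa [div_mul_cancel₀ _ hE.ne']
  -- Constants suffice for `c` and `h` because all bounds are uniform on the support.
  refine ⟨γ, fun _ => 1, fun _ => (C * (R' / κ) + R') / κ, hγ, fun _ => zero_le_one,
    fun _ => by positivity, integrable_const _, integrable_const _, by simpa using hBint, ?_⟩
  intro L hL K Ξ hΞ x y hy xK yK hK
  refine ⟨by simpa using hγle L hL K Ξ hΞ x y hy xK yK hK, fun i ξ hξ hv => ?_⟩
  have h₁ := hfirst L hL K Ξ hΞ x y hy xK yK hK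
  have h₂ := hresidual L hL K Ξ hΞ xK yK hK i ξ hξ
  calc ‖yK i - y ξ‖ ≤ (C * ‖xK - x‖ + ‖D.residual P (Ξ i) xK (yK i) ξ‖) / κ :=
        hD.norm_second_sub_le hΞ hK hξ hv
    _ ≤ (C * (R' / κ * L * mesh Ξ) + L * mesh Ξ * R') / κ := by gcongr
    _ = (C * (R' / κ) + R') / κ * L * mesh Ξ := by ring
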